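/- Let $(X,\Delta^\vee,\Lambda,\Delta)$ be a reduced root datum, with character lattice $X$, finite set of roots $\Delta^\vee\subset X$, cocharacter (coweight) lattice $\Lambda$, finite set of coroots $\Delta\subset\Lambda$ and perfect pairing $\langle\cdot,\cdot\rangle\colon X\times\Lambda\to\mathbb Z$, together with a choice of simple roots and hence of positive roots $\Delta^\vee_+$ (for example, the root datum of a connected reductive complex algebraic group $G$ with a maximal torus $T$ and a Borel subgroup $B\supset T$). Let $W$ be its Weyl group. A coweight $\lambda\in\Lambda$ is dominant if $\langle\alpha^\vee,\lambda\rangle\ge 0$ for all $\alpha^\vee\in\Delta^\vee_+$; write $\Lambda^+$ for the set of dominant coweights. For $\mu,\lambda\in\Lambda$ write $\mu\le\lambda$ if $\lambda-\mu$ is a sum of simple coroots with non-negative integer coefficients. For $\mu\in\Lambda$ let $\mu^+$ be the dominant representative of the orbit $W\mu$. For every coweight $\mu\in\Lambda$ the following two conditions are equivalent: (1) $\langle\alpha^\vee,\mu\rangle\ge -1$ for every positive root $\alpha^\vee\in\Delta^\vee_+$; (2) for every dominant coweight $\lambda'\in\Lambda^+$, if $\mu\le\lambda'\le\mu^+$ then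 $\lambda'=\mu^+$ (that is, no dominant $\lambda'$ satisfies $\mu\le\lambda'<\mu^+$). -/

import Mathlib

/-!
By the exchange property of reflections, a dominant coweight is the largest element of its Weyl
orbit.

If `μ` pairs to at least `-1` with every positive root and is not dominant, some simple root pairs
with it to exactly `-1`, so the corresponding reflection adds a single simple coroot `α^∨` to `μ`,
and it preserves the lower bound `-1`. Whenever `μ ≤ ν` with `ν` dominant, `α^∨` is one of the
simple coroots making up `ν - μ`. Hence one climbs inside the orbit, staying below `ν`, until
reaching `μ⁺ ≤ ν`.

Conversely, if a positive root `α` has `⟨α, μ⟩ ≤ -2`, then `ν = (μ + α^∨)⁺` satisfies `μ ≤ ν ≤ μ⁺`.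
Equality `ν = μ⁺` would put `μ + α^∨` in the orbit of `μ`, and comparing lengths in the
Weyl-invariant form on coweights would force `⟨α, μ⟩ = -1`.
-/

namespace RootDatum

variable {ι X Y : Type*} [AddCommGroup X] [AddCommGroup Y] {P : RootDatum ι X Y}

/-- A coweight is dominant if it pairs non-negatively with every positive root. -/
def IsDominant (b : P.Base) (lam : Y) : Prop :=
  ∀ i, b.IsPos i → 0 ≤ P.toLinearMap (P.root i) lam

/-- The dominance order `mu ≤ lam` on coweights: `lam - mu` is a sum of simple coroots. -/
def DominanceLE (b : P.Base) (mu lam : Y) : Prop :=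
  lam - mu ∈ AddSubmonoid.closure (P.coroot '' b.support)

/-- The orbit of a coweight under the Weyl group. Mathlib's action of the Weyl group on
coweights is a right action, hence `op`; the set of transformations of `Y` is the group generated
by the coreflections `y ↦ y - ⟨α, y⟩ α^∨`. -/
def weylOrbit (P : RootDatum ι X Y) (mu : Y) : Set Y :=
  MulAction.orbit P.weylGroup.op mu

lemma pairing_op_smul (g : P.Aut) (i : ι) (mu : Y) :
    P.toLinearMap (P.root i) (MulOpposite.op g • mu) = P.toLinearMap (P.root (g.indexEquiv i)) mu := by
  have h := RootPairing.Hom.weight_coweight_transpose_apply P P mu g.toHom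
  have h' := LinearMap.congr_fun h (P.root i)
  have h2 := RootPairing.Hom.root_weightMap_apply P P i g.toHom
  simp only [LinearMap.dualMap_apply] at h'
  rw [h2] at h'
  exact h'.symm

lemma coreflection_mem_weylOrbit {mu nu : Y} (h : nu ∈ weylOrbit P mu) (j : ι) :
    P.coreflection j nu ∈ weylOrbit P mu := by
  obtain ⟨g, rfl⟩ := h
  exact ⟨⟨MulOpposite.op (RootPairing.Equiv.reflection P j), P.reflection_mem_weylGroup j⟩ * g,
    mul_smul _ _ _⟩

/-- Every Weyl group orbit of coweights contains a dominant coweight. -/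
theorem exists_isDominant_mem_weylOrbit [Finite ι] [P.IsReduced] (b : P.Base) (mu : Y) :
    ∃ nu ∈ weylOrbit P mu, IsDominant b nu := by
  classical
  have := Fintype.ofFinite ι
  let f : Y → ℤ := fun nu ↦ ∑ i with b.IsPos i, P.toLinearMap (P.root i) nu
  have hbdd : ∀ nu ∈ weylOrbit P mu, f nu ≤ ∑ i : ι, |P.toLinearMap (P.root i) mu| := by
    rintro _ ⟨⟨g, hg⟩, rfl⟩
    obtain ⟨g, rfl⟩ := MulOpposite.op_surjective g
    calc f (MulOpposite.op g • mu)
        = ∑ i with b.IsPos i, P.toLinearMap (P.root (g.indexEquiv i)) mu :=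
          Finset.sum_congr rfl fun i _ ↦ pairing_op_smul g i mu
      _ ≤ ∑ i with b.IsPos i, |P.toLinearMap (P.root (g.indexEquiv i)) mu| :=
          Finset.sum_le_sum fun i _ ↦ le_abs_self _
      _ ≤ ∑ i : ι, |P.toLinearMap (P.root (g.indexEquiv i)) mu| :=
          Finset.sum_le_sum_of_subset_of_nonneg (Finset.filter_subset _ _)
            fun _ _ _ ↦ abs_nonneg _
      _ = _ := g.indexEquiv.sum_comp fun i ↦ |P.toLinearMap (P.root i) mu|
  obtain ⟨m, ⟨nu, hnu, rfl⟩, hmax⟩ := Int.exists_greatest_of_bdd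
    (P := fun z ↦ ∃ nu ∈ weylOrbit P mu, f nu = z)
    ⟨_, by rintro _ ⟨nu, hnu, rfl⟩; exact hbdd nu hnu⟩
    ⟨f mu, mu, MulAction.mem_orbit_self mu, rfl⟩
  have hsimple : ∀ j ∈ b.support, 0 ≤ P.toLinearMap (P.root j) nu := by
    intro j hj
    have hle := hmax _ ⟨_, coreflection_mem_weylOrbit hnu j, rfl⟩
    have hjpos : j ∈ ({i | b.IsPos i} : Finset ι) := by
      simpa using RootPairing.Base.isPos_of_mem_support hj
    have key : ∀ i, P.toLinearMap (P.root i) (P.coreflection j nu)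
        = P.toLinearMap (P.root (P.reflectionPerm j i)) nu := fun i ↦ by
      rw [← P.reflectionPerm_root, P.coreflection_apply]
      simp [mul_comm]
    have hf : f (P.coreflection j nu) = f nu - 2 * P.toLinearMap (P.root j) nu := by
      simp only [f]
      rw [← Finset.add_sum_erase _ _ hjpos, ← Finset.add_sum_erase _ _ hjpos]
      have hperm : ∑ i ∈ ({i | b.IsPos i} : Finset ι).erase j,
            P.toLinearMap (P.root i) (P.coreflection j nu)
          = ∑ i ∈ ({i | b.IsPos i} : Finset ι).erase j, P.toLinearMap (P.root i) nu := by
        have hmem : ∀ i ∈ ({i | b.IsPos i} : Finset ι).erase j,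
            P.reflectionPerm j i ∈ ({i | b.IsPos i} : Finset ι).erase j := by
          intro i hi
          simp only [Finset.mem_erase, Finset.mem_filter, Finset.mem_univ, true_and] at hi ⊢
          refine ⟨fun h ↦ ?_, hi.2.reflectionPerm hj hi.1⟩
          have hneg : i = P.reflectionPerm j j := by
            have h' := congrArg (P.reflectionPerm j) h
            simpa only [P.reflectionPerm_self] using h'
          let _ := P.indexNeg
          rw [hneg] at hi
          exact (RootPairing.Base.IsPos.neg_iff_not b j).mp hi.2
            (RootPairing.Base.isPos_of_mem_support hj)
        exact Finset.sum_nbij' (P.reflectionPerm j) (P.reflectionPerm j) hmem hmem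
          (by simp) (by simp) (fun i _ ↦ key i)
      rw [hperm, key, ← P.reflectionPerm_root, P.root_coroot_two]
      simp
      ring
    linarith
  refine ⟨nu, hnu, fun i hi ↦ ?_⟩
  refine hi.induction_on_add hsimple fun i j k hk hi hj ↦ ?_
  rw [hk, map_add, LinearMap.add_apply]
  exact add_nonneg hi (hsimple j hj)

/-- The dominant representative `mu⁺` of the Weyl group orbit of `mu`. -/
noncomputable def dominantRep [Finite ι] [P.IsReduced] (b : P.Base) (mu : Y) : Y :=
  (exists_isDominant_mem_weylOrbit b mu).choose

theorem dominantRep_mem_weylOrbit [Finite ι] [P.IsReduced] (b : P.Base) (mu : Y) :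
    dominantRep b mu ∈ weylOrbit P mu :=
  (exists_isDominant_mem_weylOrbit b mu).choose_spec.1

theorem isDominant_dominantRep [Finite ι] [P.IsReduced] (b : P.Base) (mu : Y) :
    IsDominant b (dominantRep b mu) :=
  (exists_isDominant_mem_weylOrbit b mu).choose_spec.2

end RootDatum

namespace Coweight

section RootPairing

variable {ι R M N : Type*} [CommRing R] [AddCommGroup M] [Module R M] [AddCommGroup N] [Module R N]
  {P : RootPairing ι R M N}

lemma toLinearMap_root_coreflection (i j : ι) (y : N) :
    P.toLinearMap (P.root i) (P.coreflection j y) =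
      P.toLinearMap (P.root (P.reflectionPerm j i)) y :=
  P.flip.coroot'_reflection y

lemma coreflection_reflectionPerm (i j : ι) :
    P.coreflection (P.reflectionPerm j i) =
      P.coreflection j * P.coreflection i * P.coreflection j :=
  P.flip.reflection_reflectionPerm

lemma corootForm_coreflection_coreflection_apply [Fintype ι] (i : ι) (x y : N) :
    P.CorootForm (P.coreflection i x) (P.coreflection i y) = P.CorootForm x y :=
  P.flip.rootForm_reflection_reflection_apply i x y

lemma corootForm_add_coroot_self [Fintype ι] (x : N) (i : ι) :
    P.CorootForm (x + P.coroot i) (x + P.coroot i) = P.CorootForm x x +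
      (P.toLinearMap (P.root i) x + 1) * P.CorootForm (P.coroot i) (P.coroot i) := by
  have hcross : P.CorootForm (P.coroot i) (P.coroot i) * P.toLinearMap (P.root i) x =
      2 * P.CorootForm (P.coroot i) x := by
    simpa only [map_smul, map_nsmul, LinearMap.smul_apply, smul_eq_mul, nsmul_eq_mul,
      Nat.cast_ofNat, P.toLinearMap_apply_CoPolarization] using
      congrArg (P.toLinearMap · x) (P.corootForm_self_smul_root i)
  have hsymm : P.CorootForm x (P.coroot i) = P.CorootForm (P.coroot i) x :=
    P.flip.rootForm_symmetric.eq _ _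
  simp only [map_add, LinearMap.add_apply, hsymm]
  linear_combination -hcross

variable (b : P.Base)

/-- The product of the simple coreflections indexed by a word in the simple roots. -/
def simpleCoreflectionProd (l : List b.support) : N ≃ₗ[R] N :=
  (l.map fun j ↦ P.coreflection j).prod

lemma simpleCoreflectionProd_cons (j : b.support) (l : List b.support) :
    simpleCoreflectionProd b (j :: l) = P.coreflection j * simpleCoreflectionProd b l :=
  List.prod_cons

lemma simpleCoreflectionProd_append (l m : List b.support) :
    simpleCoreflectionProd b (l ++ m) =
      simpleCoreflectionProd b l * simpleCoreflectionProd b m := by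
  simp [simpleCoreflectionProd]

variable {b} [CharZero R] [IsDomain R] [P.IsCrystallographic] [Finite ι]

lemma root_mem_closure_of_isPos {i : ι} (hi : b.IsPos i) :
    P.root i ∈ AddSubmonoid.closure (P.root '' b.support) := by
  refine hi.induction_on_add (p := fun i ↦ P.root i ∈ AddSubmonoid.closure (P.root '' b.support))
    (fun j hj ↦ AddSubmonoid.subset_closure ⟨j, hj, rfl⟩) fun i j k hk hi hj ↦ ?_
  exact hk ▸ add_mem hi (AddSubmonoid.subset_closure ⟨j, hj, rfl⟩)

variable [P.IsReduced]

lemma isPos_flip_of_isPos {i : ι} (hi : b.IsPos i) : b.flip.IsPos i := by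
  have : Module.IsReflexive R M := .of_isPerfPair P.toLinearMap
  have : Module.IsReflexive R N := .of_isPerfPair P.toLinearMap.flip
  have : P.flip.IsReduced := RootPairing.instFlipIsReduced P
  refine hi.induction_on_reflect (p := fun i ↦ b.IsPos i → b.flip.IsPos i)
    (fun j hj _ ↦ RootPairing.Base.isPos_of_mem_support (b := b.flip) hj) ?_ hi
  intro i j ih hj hpos
  by_cases hij : P.reflectionPerm j i = j
  · rw [hij]
    exact RootPairing.Base.isPos_of_mem_support (b := b.flip) hj
  have hi : b.IsPos i := by simpa using hpos.reflectionPerm hj hij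
  have hne : i ≠ j := by
    rintro rfl
    exact (RootPairing.Base.IsPos.neg_iff_not b i).mp hpos hi
  exact RootPairing.Base.IsPos.reflectionPerm (b := b.flip) (ih hi) hj hne

lemma coroot_mem_closure_of_isPos {i : ι} (hi : b.IsPos i) :
    P.coroot i ∈ AddSubmonoid.closure (P.coroot '' b.support) :=
  root_mem_closure_of_isPos (P := P.flip) (b := b.flip) (isPos_flip_of_isPos hi)

variable (b) in
lemma exists_coreflection_eq_simpleCoreflectionProd (i : ι) :
    ∃ l, P.coreflection i = simpleCoreflectionProd b l := by
  refine b.induction_reflect i (p := fun i ↦ ∃ l, P.coreflection i = simpleCoreflectionProd b l)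
    ?_ (fun j hj ↦ ⟨[⟨j, hj⟩], by simp [simpleCoreflectionProd]⟩) ?_
  · rintro i ⟨l, hl⟩
    refine ⟨l, ?_⟩
    rw [coreflection_reflectionPerm, ← sq, P.coreflection_sq, one_mul, hl]
  · rintro i j ⟨l, hl⟩ hj
    refine ⟨⟨j, hj⟩ :: (l ++ [⟨j, hj⟩]), ?_⟩
    rw [coreflection_reflectionPerm, hl, simpleCoreflectionProd_cons, simpleCoreflectionProd_append,
      mul_assoc]
    simp [simpleCoreflectionProd]

end RootPairing

lemma eq_zero_of_mem_closure_of_neg_mem_closure {κ A : Type*} [AddCommGroup A] {v : κ → A}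
    {s : Set κ} (hv : LinearIndepOn ℕ v s) {x : A} (hx : x ∈ AddSubmonoid.closure (v '' s))
    (hx' : -x ∈ AddSubmonoid.closure (v '' s)) : x = 0 := by
  rw [← Submodule.span_nat_eq_addSubmonoidClosure, Submodule.mem_toAddSubmonoid,
    Finsupp.mem_span_image_iff_linearCombination] at hx hx'
  obtain ⟨c, hc, rfl⟩ := hx
  obtain ⟨d, hd, hcd⟩ := hx'
  have hsum : c + d = 0 := linearIndepOn_iffₛ.mp hv _ (add_mem hc hd) 0 (zero_mem _) (by simp [hcd])
  rw [(add_eq_zero.mp hsum).1, map_zero]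

open RootDatum

variable {ι X Y : Type*} [AddCommGroup X] [AddCommGroup Y] {P : RootDatum ι X Y}

instance (b : P.Base) : IsPartialOrder Y (DominanceLE b) where
  refl x := by simp [DominanceLE]
  trans x y z hxy hyz := by
    unfold DominanceLE at *
    simpa using add_mem hyz hxy
  antisymm x y hxy hyx := by
    refine (sub_eq_zero.mp ?_).symm
    exact eq_zero_of_mem_closure_of_neg_mem_closure
      (b.linearIndepOn_coroot.restrict_scalars' ℕ) hxy (by rwa [neg_sub])

lemma dominanceLE_of_sub_eq_zsmul {b : P.Base} {x y v : Y} {k : ℤ} (hk : 0 ≤ k)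
    (hv : v ∈ AddSubmonoid.closure (P.coroot '' b.support)) (h : y - x = k • v) :
    DominanceLE b x y := by
  lift k to ℕ using hk
  rw [DominanceLE, h, natCast_zsmul]
  exact nsmul_mem hv k

lemma coreflection_dominanceLE {b : P.Base} {j : ι} (hj : j ∈ b.support) {x : Y}
    (hx : 0 ≤ P.toLinearMap (P.root j) x) : DominanceLE b (P.coreflection j x) x :=
  dominanceLE_of_sub_eq_zsmul hx (AddSubmonoid.subset_closure ⟨j, hj, rfl⟩) <| by
    rw [P.coreflection_apply, sub_sub_cancel]

lemma dominanceLE_add_coroot [Finite ι] [P.IsReduced] {b : P.Base} {i : ι} (hi : b.IsPos i)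
    (x : Y) : DominanceLE b x (x + P.coroot i) := by
  simpa [DominanceLE] using coroot_mem_closure_of_isPos hi

lemma weylOrbit_induction {p : Y → Prop} {x y : Y} (hy : y ∈ weylOrbit P x) (base : p x)
    (coreflection : ∀ z i, p z → p (P.coreflection i z)) : p y := by
  obtain ⟨⟨g, hg⟩, rfl⟩ := hy
  obtain ⟨g, rfl⟩ := MulOpposite.op_surjective g
  suffices ∀ z : Y, p z → p (MulOpposite.op g • z) from this x base
  replace hg : g ∈ P.weylGroup := hg
  induction hg using RootPairing.weylGroup.induction with
  | mem i => exact fun z ↦ coreflection z i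
  | one => simp
  | mul g h _ _ ihg ihh =>
    intro z hz
    rw [MulOpposite.op_mul, mul_smul]
    exact ihh _ (ihg z hz)

lemma mem_weylOrbit_symm {x y : Y} (h : y ∈ weylOrbit P x) : x ∈ weylOrbit P y :=
  MulAction.mem_orbit_symm.mp h

lemma mem_weylOrbit_trans {x y z : Y} (hz : z ∈ weylOrbit P y) (hy : y ∈ weylOrbit P x) :
    z ∈ weylOrbit P x :=
  (MulAction.orbit_eq_iff.mpr hy).subset hz

lemma corootForm_self_eq_of_mem_weylOrbit [Fintype ι] {x y : Y} (h : y ∈ weylOrbit P x) :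
    P.CorootForm y y = P.CorootForm x x :=
  weylOrbit_induction (p := fun z ↦ P.CorootForm z z = P.CorootForm x x) h rfl fun z i hz ↦ by
    rw [corootForm_coreflection_coreflection_apply, hz]

lemma root_apply_eq_neg_one_of_add_coroot_mem_weylOrbit [Finite ι] {x : Y} {i : ι}
    (h : x + P.coroot i ∈ weylOrbit P x) : P.toLinearMap (P.root i) x = -1 := by
  cases nonempty_fintype ι
  have hform := corootForm_self_eq_of_mem_weylOrbit h
  rw [corootForm_add_coroot_self, add_eq_left] at hform
  exact eq_neg_of_add_eq_zero_left <| (mul_eq_zero.mp hform).resolve_right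
    (RootPairing.IsAnisotropic.corootForm_coroot_ne_zero i)

lemma exists_root_apply_eq_of_mem_weylOrbit_add_coroot {x y : Y} {i : ι}
    (h : y ∈ weylOrbit P (x + P.coroot i)) :
    ∃ z ∈ weylOrbit P x, ∃ j, y = z + P.coroot j ∧
      P.toLinearMap (P.root j) z = P.toLinearMap (P.root i) x := by
  refine weylOrbit_induction (p := fun y ↦ ∃ z ∈ weylOrbit P x, ∃ j, y = z + P.coroot j ∧
    P.toLinearMap (P.root j) z = P.toLinearMap (P.root i) x) h
    ⟨x, MulAction.mem_orbit_self x, i, rfl, rfl⟩ ?_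
  rintro _ k ⟨z, hz, j, rfl, hj⟩
  refine ⟨P.coreflection k z, coreflection_mem_weylOrbit hz k, P.reflectionPerm k j, ?_, ?_⟩
  · rw [map_add, P.coroot_reflectionPerm]
  · rw [toLinearMap_root_coreflection, P.reflectionPerm_self, hj]

/-- A coweight is almost dominant if its pairings with the positive roots are at least `-1`. -/
def IsAlmostDominant (b : P.Base) (x : Y) : Prop :=
  ∀ i, b.IsPos i → -1 ≤ P.toLinearMap (P.root i) x

section Finite

variable [Finite ι] {b : P.Base}

lemma isDominant_of_forall_mem_support {y : Y}
    (h : ∀ j ∈ b.support, 0 ≤ P.toLinearMap (P.root j) y) : IsDominant b y := by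
  refine fun i hi ↦ hi.induction_on_add h fun i j k hk hi hj ↦ ?_
  rw [hk, map_add, LinearMap.add_apply]
  exact add_nonneg hi (h j hj)

/-- Distinct simple roots pair non-positively, so only a summand `P.coroot j` can contribute. -/
lemma coroot_mem_of_root_apply_sum_pos {s : Multiset Y} (hs : ∀ v ∈ s, v ∈ P.coroot '' b.support)
    {j : ι} (hj : j ∈ b.support) (hpos : 0 < P.toLinearMap (P.root j) s.sum) :
    P.coroot j ∈ s := by
  contrapose! hpos
  rw [map_multiset_sum]
  refine (Multiset.sum_le_card_nsmul _ 0 fun n hn ↦ ?_).trans_eq (smul_zero _)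
  obtain ⟨v, hv, rfl⟩ := Multiset.mem_map.mp hn
  obtain ⟨k, hk, rfl⟩ := hs v hv
  have hjk : j ≠ k := by
    rintro rfl
    exact hpos hv
  simpa [← P.algebraMap_pairingIn ℤ] using b.pairingIn_le_zero_of_ne hjk hj hk

variable [P.IsReduced]

lemma exists_eq_simpleCoreflectionProd_of_mem_weylOrbit (b : P.Base) {x y : Y}
    (h : y ∈ weylOrbit P x) : ∃ l, y = simpleCoreflectionProd b l x := by
  refine weylOrbit_induction (p := fun y ↦ ∃ l, y = simpleCoreflectionProd b l x) h ⟨[], rfl⟩ ?_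
  rintro _ i ⟨l, rfl⟩
  obtain ⟨m, hm⟩ := exists_coreflection_eq_simpleCoreflectionProd b i
  exact ⟨m ++ l, by rw [simpleCoreflectionProd_append, hm, LinearEquiv.mul_apply]⟩

/-- The exchange property: carry the root `i` through the word from the left and delete the letter
where it meets its own simple reflection. It must meet one, as otherwise it would stay positive and
pair negatively with the dominant `x`. -/
lemma exists_shorter_simpleCoreflectionProd {x : Y} (hx : IsDominant b x) (l : List b.support)
    {i : ι} (hi : b.IsPos i)
    (hneg : P.toLinearMap (P.root i) (simpleCoreflectionProd b l x) < 0) :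
    ∃ m : List b.support, m.length < l.length ∧
      P.coreflection i (simpleCoreflectionProd b l x) = simpleCoreflectionProd b m x := by
  induction l generalizing i with
  | nil => exact absurd hneg (hx i hi).not_gt
  | cons t l ih =>
    rw [simpleCoreflectionProd_cons, LinearEquiv.mul_apply] at hneg ⊢
    by_cases hit : i = t
    · exact ⟨l, by simp, by rw [hit, P.coreflection_same]⟩
    · rw [toLinearMap_root_coreflection] at hneg
      obtain ⟨m, hlen, hm⟩ := ih (hi.reflectionPerm t.2 hit) hneg
      refine ⟨t :: m, by simpa using hlen, ?_⟩
      rw [simpleCoreflectionProd_cons, LinearEquiv.mul_apply, ← hm, coreflection_reflectionPerm]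
      simp only [LinearEquiv.mul_apply, P.coreflection_same]

lemma simpleCoreflectionProd_dominanceLE {x : Y} (hx : IsDominant b x) (l : List b.support) :
    DominanceLE b (simpleCoreflectionProd b l x) x := by
  induction hn : l.length using Nat.strong_induction_on generalizing l with
  | _ n ih =>
  subst hn
  cases l with
  | nil => exact refl_of (DominanceLE b) x
  | cons t l =>
    rw [simpleCoreflectionProd_cons, LinearEquiv.mul_apply]
    rcases le_or_gt 0 (P.toLinearMap (P.root t) (simpleCoreflectionProd b l x)) with hle | hlt
    · exact _root_.trans (coreflection_dominanceLE t.2 hle) (ih _ (by simp) l rfl)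
    · obtain ⟨m, hlen, hm⟩ := exists_shorter_simpleCoreflectionProd hx l
        (RootPairing.Base.isPos_of_mem_support t.2) hlt
      rw [hm]
      exact ih _ (hlen.trans (by simp)) m rfl

lemma dominanceLE_of_mem_weylOrbit {x y : Y} (hx : IsDominant b x) (hy : y ∈ weylOrbit P x) :
    DominanceLE b y x := by
  obtain ⟨l, rfl⟩ := exists_eq_simpleCoreflectionProd_of_mem_weylOrbit b hy
  exact simpleCoreflectionProd_dominanceLE hx l

/-- On the line through `y` in the direction of the coroot, `y + P.coroot i` lies between `y` and
its reflection, so it is below whichever of the two is higher. -/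
lemma add_coroot_dominanceLE_of_mem_weylOrbit {x y : Y} {i : ι} (hx : IsDominant b x)
    (hy : y ∈ weylOrbit P x) (hi : P.toLinearMap (P.root i) y ≤ -1) :
    DominanceLE b (y + P.coroot i) x := by
  rcases b.coroot_mem_or_neg_mem i with hpos | hneg
  · have hsub : P.coreflection i y - (y + P.coroot i) =
        (-1 - P.toLinearMap (P.root i) y) • P.coroot i := by
      rw [P.coreflection_apply, RootPairing.root']
      module
    exact _root_.trans (dominanceLE_of_sub_eq_zsmul (by lia) hpos hsub)
      (dominanceLE_of_mem_weylOrbit hx (coreflection_mem_weylOrbit hy i))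
  · have hle : DominanceLE b (y + P.coroot i) y := by simpa [DominanceLE] using hneg
    exact _root_.trans hle (dominanceLE_of_mem_weylOrbit hx hy)

lemma dominanceLE_of_mem_weylOrbit_add_coroot {x y z : Y} {i : ι} (hx : IsDominant b x)
    (hy : y ∈ weylOrbit P x) (hi : P.toLinearMap (P.root i) y ≤ -1)
    (hz : z ∈ weylOrbit P (y + P.coroot i)) : DominanceLE b z x := by
  obtain ⟨u, hu, j, rfl, hj⟩ := exists_root_apply_eq_of_mem_weylOrbit_add_coroot hz
  exact add_coroot_dominanceLE_of_mem_weylOrbit hx (mem_weylOrbit_trans hu hy) (hj ▸ hi)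

lemma IsAlmostDominant.coreflection {x : Y} (hx : IsAlmostDominant b x) {j : ι}
    (hj : j ∈ b.support) (hle : P.toLinearMap (P.root j) x ≤ 1) :
    IsAlmostDominant b (P.coreflection j x) := by
  intro i hi
  by_cases hij : i = j
  · subst hij
    rw [toLinearMap_root_coreflection, P.root_reflectionPerm, P.reflection_apply_self, map_neg,
      LinearMap.neg_apply]
    exact neg_le_neg hle
  · rw [toLinearMap_root_coreflection]
    exact hx _ (hi.reflectionPerm hj hij)

lemma IsAlmostDominant.exists_isDominant_dominanceLE {x y : Y} (hx : IsAlmostDominant b x)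
    (hy : IsDominant b y) (hxy : DominanceLE b x y) :
    ∃ z ∈ weylOrbit P x, IsDominant b z ∧ DominanceLE b z y := by
  classical
  obtain ⟨s, hs, hsum⟩ := AddSubmonoid.exists_multiset_of_mem_closure hxy
  induction s using Multiset.strongInductionOn generalizing x with
  | _ s ih =>
  by_cases hdom : ∀ j ∈ b.support, 0 ≤ P.toLinearMap (P.root j) x
  · exact ⟨x, MulAction.mem_orbit_self x, isDominant_of_forall_mem_support hdom, hxy⟩
  push Not at hdom
  obtain ⟨j, hj, hneg⟩ := hdom
  have hjpos : b.IsPos j := RootPairing.Base.isPos_of_mem_support hj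
  have hrefl : P.coreflection j x = x + P.coroot j := by
    have hj1 : P.toLinearMap (P.root j) x = -1 := le_antisymm (by lia) (hx j hjpos)
    rw [P.coreflection_apply, RootPairing.root', hj1, neg_one_zsmul, sub_neg_eq_add]
  have hmem : P.coroot j ∈ s := coroot_mem_of_root_apply_sum_pos hs hj <| by
    rw [hsum, map_sub]
    linarith [hy j hjpos]
  have herase : (s.erase (P.coroot j)).sum = y - P.coreflection j x := by
    rw [hrefl, ← sub_sub, ← hsum, ← Multiset.sum_erase hmem, add_sub_cancel_left]
  have hs' : ∀ v ∈ s.erase (P.coroot j), v ∈ P.coroot '' b.support :=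
    fun v hv ↦ hs v (Multiset.mem_of_mem_erase hv)
  have hle : DominanceLE b (P.coreflection j x) y := by
    rw [DominanceLE, ← herase]
    exact multiset_sum_mem _ fun v hv ↦ AddSubmonoid.subset_closure (hs' v hv)
  obtain ⟨z, hz, hzdom, hzle⟩ := ih _ (Multiset.erase_lt.mpr hmem)
    (hx.coreflection hj (by lia)) hle hs' herase
  exact ⟨z, mem_weylOrbit_trans hz (coreflection_mem_weylOrbit (MulAction.mem_orbit_self x) j),
    hzdom, hzle⟩

end Finite

end Coweight

theorem mainTheorem11_general {ι X Y : Type*} [Finite ι] [AddCommGroup X]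
    [AddCommGroup Y] (P : RootDatum ι X Y) [P.IsReduced] (b : P.Base)
    (mu : Y) :
    (∀ i, b.IsPos i → -1 ≤ P.toLinearMap (P.root i) mu) ↔
      (∀ lam : Y, RootDatum.IsDominant b lam → RootDatum.DominanceLE b mu lam →
        RootDatum.DominanceLE b lam (RootDatum.dominantRep b mu) →
          lam = RootDatum.dominantRep b mu) := by
  open RootDatum Coweight in
  have hrep := dominantRep_mem_weylOrbit b mu
  refine ⟨fun halmost lam hlam hmu hle ↦ ?_, fun hmax i hi ↦ ?_⟩
  · obtain ⟨nu, hnu, hdom, hnule⟩ :=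
      IsAlmostDominant.exists_isDominant_dominanceLE halmost hlam hmu
    have hrep_le : DominanceLE b (dominantRep b mu) nu :=
      dominanceLE_of_mem_weylOrbit hdom (mem_weylOrbit_trans hrep (mem_weylOrbit_symm hnu))
    exact antisymm hle (_root_.trans hrep_le hnule)
  · by_contra! hlt
    have hnu := dominantRep_mem_weylOrbit b (mu + P.coroot i)
    have hnu_dom := isDominant_dominantRep b (mu + P.coroot i)
    have hmu_le : DominanceLE b mu (dominantRep b (mu + P.coroot i)) :=
      _root_.trans (dominanceLE_add_coroot hi mu)
        (dominanceLE_of_mem_weylOrbit hnu_dom (mem_weylOrbit_symm hnu))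
    have hle : DominanceLE b (dominantRep b (mu + P.coroot i)) (dominantRep b mu) :=
      dominanceLE_of_mem_weylOrbit_add_coroot (isDominant_dominantRep b mu)
        (mem_weylOrbit_symm hrep) hlt.le hnu
    rw [hmax _ hnu_dom hmu_le hle] at hnu
    have hmem : mu + P.coroot i ∈ weylOrbit P mu :=
      mem_weylOrbit_trans (mem_weylOrbit_symm hnu) hrep
    exact hlt.ne (root_apply_eq_neg_one_of_add_coroot_mem_weylOrbit hmem)

theorem mainTheorem11 {ι X Y : Type*} [Finite ι] [AddCommGroup X] [Module.Finite ℤ X]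
    [AddCommGroup Y] [Module.Finite ℤ Y] (P : RootDatum ι X Y) [P.IsReduced] (b : P.Base)
    (mu : Y) :
    (∀ i, b.IsPos i → -1 ≤ P.toLinearMap (P.root i) mu) ↔
      (∀ lam : Y, RootDatum.IsDominant b lam → RootDatum.DominanceLE b mu lam →
        RootDatum.DominanceLE b lam (RootDatum.dominantRep b mu) →
          lam = RootDatum.dominantRep b mu) :=
  mainTheorem11_general P b mu
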